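/- Let $p$ be a prime, let $\mathbb F$ be a field of characteristic $p$, and let $(L,[\cdot,\cdot],\alpha)$ be a multiplicative Hom-Lie algebra over $\mathbb F$ (of arbitrary dimension): $L$ is an $\mathbb F$-vector space, $[\cdot,\cdot]:L\times L\to L$ is bilinear with $[x,x]=0$ for all $x$, and $\alpha:L\to L$ is linear with $\alpha([x,y])=[\alpha(x),\alpha(y)]$ and $$[\alpha(x),[y,z]]+[\alpha(y),[z,x]]+[\alpha(z),[x,y]]=0\qquad(x,y,z\in L).$$ Write $\operatorname{ad}(x)(z)=[x,z]$. A $p$-structure on $L$ is a map $[p]_\alpha:L\to L$, $x\mapsto x^{[p]_\alpha}$, such that for all $x,y\in L$ and $k\in\mathbb F$ 1. $\operatorname{ad}(x^{[p]_\alpha})\circ\alpha^{p-1}=\operatorname{ad}(\alpha^{p-1}(x))\circ\operatorname{ad}(\alpha^{p-2}(x))\circ\cdots\circ\operatorname{ad}(x)$; 2. $(kx)^{[p]_\alpha}=k^p\,x^{[p]_\alpha}$; 3. $(x+y)^{[p]_\alpha}=x^{[p]_\alpha}+y^{[p]_\alpha}+\sum_{i=1}^{p-1}s_i(x,y)$,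 where the elements $s_i(x,y)\in L$ are determined by the identity of polynomials in an indeterminate $T$ with coefficients in $L$ $$\operatorname{ad}(\alpha^{p-2}(Tx+y))\circ\operatorname{ad}(\alpha^{p-3}(Tx+y))\circ\cdots\circ\operatorname{ad}(Tx+y)(x)=\sum_{i=1}^{p-1}i\,s_i(x,y)\,T^{i-1}.$$ **Theorem.** Let $(e_j)_{j\in J}$ be a basis of $L$, and let $(y_j)_{j\in J}$ be elements of $L$ such that, for every $j\in J$, $$\operatorname{ad}(\alpha^{p-1}(e_j))\circ\operatorname{ad}(\alpha^{p-2}(e_j))\circ\cdots\circ\operatorname{ad}(e_j)=\operatorname{ad}(y_j)\circ\alpha^{p-1}.$$ Then there exists exactly one $p$-structure $[p]_\alpha:L\to L$ with $e_j^{[p]_\alpha}=y_j$ for all $j\in J$. -/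

import Mathlib

/-- A Hom-Lie algebra structure on the `F`-vector space `L`: an alternating bilinear bracket
(a linear map on the second exterior power of `L`) and a linear twist `α : L → L` satisfying the
Hom-Jacobi identity. -/
structure HomLieAlgebra (F L : Type*) [Field F] [AddCommGroup L] [Module F L] where
  /-- The bracket; `bracket x y` is `[x, y]`. -/
  bracket : L →ₗ[F] L →ₗ[F] L
  /-- The twisting map `α`. -/
  twist : L →ₗ[F] L
  bracket_self : ∀ x : L, bracket x x = 0
  hom_jacobi : ∀ x y z : L,
    bracket (twist x) (bracket y z) + bracket (twist y) (bracket z x)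
      + bracket (twist z) (bracket x y) = 0

namespace HomLieAlgebra

variable {F L : Type*} [Field F] [AddCommGroup L] [Module F L]

/-- `A` is multiplicative if `α [x, y] = [α x, α y]` for all `x, y`. -/
def IsMultiplicative (A : HomLieAlgebra F L) : Prop :=
  ∀ x y : L, A.twist (A.bracket x y) = A.bracket (A.twist x) (A.twist y)

/-- The adjoint map `ad x : z ↦ [x, z]`. -/
def ad (A : HomLieAlgebra F L) (x : L) : L →ₗ[F] L := A.bracket x

/-- `A.adIter n x` is the composition `ad (α^(n-1) x) ∘ ad (α^(n-2) x) ∘ ⋯ ∘ ad x` of `n` maps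
(the identity for `n = 0`). -/
def adIter (A : HomLieAlgebra F L) : ℕ → L → (L →ₗ[F] L)
  | 0, _ => LinearMap.id
  | n + 1, x => A.ad ((A.twist ^ n) x) ∘ₗ A.adIter n x

/-- `A.adCoeff x y n i` is the coefficient of `T ^ i` in the polynomial
`ad (α^(n-1) (T x + y)) ∘ ⋯ ∘ ad (T x + y) (x)` in the indeterminate `T` with coefficients in `L`.
Applying `ad (α^n (T x + y)) = T ad (α^n x) + ad (α^n y)` to the polynomial for `n` gives
the polynomial for `n + 1`. -/
def adCoeff (A : HomLieAlgebra F L) (x y : L) : ℕ → ℕ → L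
  | 0, 0 => x
  | 0, _ + 1 => 0
  | n + 1, 0 => A.ad ((A.twist ^ n) y) (A.adCoeff x y n 0)
  | n + 1, i + 1 =>
      A.ad ((A.twist ^ n) x) (A.adCoeff x y n i) + A.ad ((A.twist ^ n) y) (A.adCoeff x y n (i + 1))

/-- The elements `s_i(x, y)`, `1 ≤ i ≤ p - 1`, determined by
`ad (α^(p-2) (T x + y)) ∘ ⋯ ∘ ad (T x + y) (x) = ∑_{i=1}^{p-1} i s_i(x, y) T^(i-1)`
(see `adIter_apply_eq_sum`). -/
def s (A : HomLieAlgebra F L) (p i : ℕ) (x y : L) : L :=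
  (i : F)⁻¹ • A.adCoeff x y (p - 1) (i - 1)

/-- `f : L → L`, written `x ↦ x^{[p]_α}`, is a `p`-structure on the (multiplicative) Hom-Lie
algebra `A`. -/
structure IsPStructure (A : HomLieAlgebra F L) (p : ℕ) (f : L → L) : Prop where
  ad_comp : ∀ x : L, A.ad (f x) ∘ₗ (A.twist ^ (p - 1)) = A.adIter p x
  map_smul : ∀ (k : F) (x : L), f (k • x) = k ^ p • f x
  map_add : ∀ x y : L, f (x + y) = f x + f y + ∑ i ∈ Finset.Icc 1 (p - 1), A.s p i x y

theorem adCoeff_eq_zero (A : HomLieAlgebra F L) (x y : L) :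
    ∀ n i : ℕ, n ≤ i → 0 < i → A.adCoeff x y n i = 0 := by
  intro n
  induction n with
  | zero =>
    intro i _ hi
    obtain ⟨i, rfl⟩ := Nat.exists_eq_succ_of_ne_zero hi.ne'
    rfl
  | succ n ih =>
    intro i hni hi
    obtain ⟨i, rfl⟩ := Nat.exists_eq_succ_of_ne_zero hi.ne'
    have h2 := ih (i + 1) (by omega) (by omega)
    rcases Nat.eq_zero_or_pos i with rfl | hi'
    · obtain rfl : n = 0 := by omega
      simp [adCoeff, ad, A.bracket_self]
    · simp [adCoeff, h2, ih i (by omega) hi']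

theorem adIter_apply_eq_sum_range (A : HomLieAlgebra F L) (x y : L) (k : F) (n : ℕ) :
    A.adIter n (k • x + y) x = ∑ i ∈ Finset.range (n + 1), k ^ i • A.adCoeff x y n i := by
  induction n with
  | zero => simp [adIter, adCoeff]
  | succ n ih =>
    have h0 : A.adCoeff x y n (n + 1) = 0 := A.adCoeff_eq_zero x y n (n + 1) (by omega) (by omega)
    have hx : ∀ i, k ^ (i + 1) • A.adCoeff x y (n + 1) (i + 1) =
        k • k ^ i • A.bracket ((A.twist ^ n) x) (A.adCoeff x y n i) +
          k ^ (i + 1) • A.bracket ((A.twist ^ n) y) (A.adCoeff x y n (i + 1)) := by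
      intro i
      simp only [adCoeff, ad, smul_add]
      rw [smul_smul k, ← pow_succ']
    have hy := Finset.sum_range_succ'
      (fun i => k ^ i • A.bracket ((A.twist ^ n) y) (A.adCoeff x y n i)) (n + 1)
    rw [Finset.sum_range_succ, h0, map_zero, smul_zero, add_zero] at hy
    rw [adIter, LinearMap.comp_apply, ih, Finset.sum_range_succ' _ (n + 1),
      Finset.sum_congr rfl fun i _ => hx i, Finset.sum_add_distrib, ← Finset.smul_sum, add_assoc]
    simp only [ad, map_add, map_smul, map_sum, LinearMap.add_apply, LinearMap.smul_apply,
      smul_add, Finset.sum_add_distrib]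
    rw [hy, Finset.smul_sum]
    simp [adCoeff, ad, smul_comm k]

/-- The defining equation of the elements `s_i(x, y)`. -/
theorem adIter_apply_eq_sum (A : HomLieAlgebra F L) (p : ℕ) [hp : Fact p.Prime] [CharP F p]
    (x y : L) (k : F) :
    A.adIter (p - 1) (k • x + y) x =
      ∑ i ∈ Finset.Icc 1 (p - 1), ((i : F) * k ^ (i - 1)) • A.s p i x y := by
  have h2 := hp.out.two_le
  rw [adIter_apply_eq_sum_range, Finset.sum_range_succ,
    A.adCoeff_eq_zero x y (p - 1) (p - 1) le_rfl (by omega), smul_zero, add_zero,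
    Finset.range_eq_Ico, ← Finset.Ico_add_one_right_eq_Icc,
    ← Finset.sum_Ico_add' _ 0 (p - 1) 1]
  refine Finset.sum_congr rfl fun i hi => ?_
  have hi' : i + 1 < p := by simp at hi; omega
  have hne : ((i + 1 : ℕ) : F) ≠ 0 := by
    rw [Ne, CharP.cast_eq_zero_iff F p]
    exact Nat.not_dvd_of_pos_of_lt (by omega) hi'
  rw [s, smul_smul, Nat.add_sub_cancel, mul_right_comm, mul_inv_cancel₀ hne, one_mul]

end HomLieAlgebra

/-! Write s(x, y) for the sum of the s_i(x, y). Conditions 2 and 3 say that x ↦ (x, f x) is an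
F-linear section of L × L → L, where L × L has the addition (x, u) + (y, v) = (x + y, u + v + s(x,
y)) and the scalar action k(x, u) = (kx, k^p u). Once this is a vector space (`JacobsonExtension`),
a basis determines exactly one section, and condition 1 spreads from the basis by `ad_jacobsonSum`.

The vector space axioms need s to be a symmetric 2-cocycle. In an associative algebra this is clear,
as s(x, y) = (x + y)^p - x^p - y^p (`ofAssociative_jacobsonSum`). The graded representation `rep`
absorbs the twists and transfers this formula to L, but only after acting on vectors: it gives ad
s(x, y) ∘ α^(p-1), and D s(x, y) for a derivation D commuting with α. To recover s itself, pass to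
L[T] with D = T d/dT and replace x by xT. The difference of the two sides of each identity has
degree below p, zero constant term and zero derivative, so it vanishes; then set T = 1. -/

/-! ### Jacobson's formula in associative algebras. -/

open Polynomial in
theorem derivative_pow_eq_sum {B : Type*} [Semiring B] (W : B[X]) (n : ℕ) :
    derivative (W ^ n) =
      ∑ j ∈ Finset.range n, W ^ j * derivative W * W ^ (n - 1 - j) := by
  induction n with
  | zero => simp
  | succ n ih =>
    rw [pow_succ, derivative_mul, ih, Finset.sum_range_succ, Finset.sum_mul]
    congr 1
    · refine Finset.sum_congr rfl fun j hj => ?_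
      have : n + 1 - 1 - j = n - 1 - j + 1 := by simp at hj; omega
      rw [this, pow_succ, mul_assoc _ (W ^ _) W]
    · simp

/-- By Pascal's rule, neighbouring entries of row p - 1 add up to an inner entry of row p, which is
divisible by p. -/
theorem cast_choose_prime_sub_one {F : Type*} [Ring F] (p : ℕ) [hp : Fact p.Prime] [CharP F p]
    (m : ℕ) (hm : m < p) : (((p - 1).choose m : ℕ) : F) = (-1) ^ m := by
  induction m with
  | zero => simp
  | succ m ih =>
    have h := Nat.choose_succ_succ (p - 1) m
    rw [Nat.succ_eq_add_one, Nat.sub_add_cancel hp.out.one_le] at h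
    have h0 : ((p.choose (m + 1) : ℕ) : F) = 0 :=
      (CharP.cast_eq_zero_iff F p _).2 (hp.out.dvd_choose_self (by omega) hm)
    rw [h, Nat.cast_add, ih (by omega)] at h0
    rw [pow_succ, mul_neg_one]
    exact (neg_eq_of_add_eq_zero_right h0).symm

/-- In characteristic `p`, `(l - r) ^ (p - 1) = ∑ l ^ j r ^ (p - 1 - j)` for commuting `l`, `r`. -/
theorem Commute.sub_pow_prime_sub_one {F E : Type*} [Field F] [Ring E] [Algebra F E]
    (p : ℕ) [hp : Fact p.Prime] [CharP F p] {l r : E} (h : Commute l r) :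
    (l - r) ^ (p - 1) = ∑ j ∈ Finset.range p, l ^ j * r ^ (p - 1 - j) := by
  have h1 := hp.out.one_le
  rw [sub_eq_add_neg, h.neg_right.add_pow, Nat.sub_add_cancel h1]
  refine Finset.sum_congr rfl fun j hj => ?_
  have hj' : j < p := Finset.mem_range.1 hj
  have hc : (((p - 1).choose j : ℕ) : E) = (-1) ^ j := by
    rw [← map_natCast (algebraMap F E), cast_choose_prime_sub_one p j hj']; simp
  -- Reading the binomial congruence at m = p - 1 avoids a parity split and covers p = 2.
  have hs : ((-1 : E)) ^ (p - 1) = 1 := by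
    have := cast_choose_prime_sub_one (F := F) p (p - 1) (by omega)
    rw [Nat.choose_self, Nat.cast_one] at this
    simpa using congrArg (algebraMap F E) this.symm
  rw [hc, neg_pow r, mul_assoc, ((Commute.neg_one_right _).pow_right j).eq, ← mul_assoc ((-1) ^ j),
    ← pow_add, Nat.add_sub_cancel' (by omega), hs, one_mul]

namespace HomLieAlgebra

variable {F L : Type*} [Field F] [AddCommGroup L] [Module F L]

/-- The sum `∑_{i=1}^{p-1} s_i(x, y)`. -/
def jacobsonSum (A : HomLieAlgebra F L) (p : ℕ) (x y : L) : L :=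
  ∑ i ∈ Finset.Icc 1 (p - 1), A.s p i x y

/-- An associative algebra with its commutator bracket and the identity as twist. -/
def ofAssociative (F B : Type*) [Field F] [Ring B] [Algebra F B] : HomLieAlgebra F B where
  bracket := LinearMap.mul F B - (LinearMap.mul F B).flip
  twist := LinearMap.id
  bracket_self x := by simp
  hom_jacobi x y z := by simp; noncomm_ring

theorem ofAssociative_ad_twist {B : Type*} [Ring B] [Algebra F B] (n : ℕ) (x y : B) :
    (ofAssociative F B).ad (((ofAssociative F B).twist ^ n) x) y = x * y - y * x := by
  have : (ofAssociative F B).twist ^ n = 1 := one_pow n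
  rw [this]
  simp [ad, ofAssociative]

-- T is central in B[T], so the recursion for `adCoeff` is the commutator with xT + y, read off
-- coefficient by coefficient.
open Polynomial in
theorem coeff_iterate_commutator {B : Type*} [Ring B] [Algebra F B] (x y : B) (n i : ℕ) :
    (((LinearMap.mulLeft F (C x * X + C y) - LinearMap.mulRight F (C x * X + C y)) ^ n :
      Module.End F B[X]) (C x)).coeff i = (ofAssociative F B).adCoeff x y n i := by
  induction n generalizing i with
  | zero => cases i <;> simp [adCoeff, coeff_C]
  | succ n ih =>
    rw [pow_succ', Module.End.mul_apply]
    set q := ((LinearMap.mulLeft F (C x * X + C y) - LinearMap.mulRight F (C x * X + C y)) ^ n :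
      Module.End F B[X]) (C x)
    have hq : q * (C x * X) = q * C x * X := (mul_assoc _ _ _).symm
    have hq' : C x * X * q = C x * q * X := by rw [mul_assoc, X_mul, mul_assoc]
    cases i with
    | zero => simp [adCoeff, ofAssociative_ad_twist, ← ih, add_mul, mul_add, hq, hq']
    | succ i =>
      simp only [adCoeff, ofAssociative_ad_twist, ← ih, LinearMap.sub_apply,
        LinearMap.mulLeft_apply, LinearMap.mulRight_apply, add_mul, mul_add, hq, hq', coeff_sub,
        coeff_add, coeff_mul_X, coeff_C_mul, coeff_mul_C]
      abel

open Polynomial in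
/-- Jacobson's formula. -/
theorem ofAssociative_jacobsonSum {B : Type*} [Ring B] [Algebra F B] (p : ℕ) [hp : Fact p.Prime]
    [CharP F p] (x y : B) :
    (ofAssociative F B).jacobsonSum p x y = (x + y) ^ p - x ^ p - y ^ p := by
  have h2 := hp.out.two_le
  set W : B[X] := C x * X + C y with hW
  -- W need not commute with its derivative x, so the derivative of W^p is the sum of the W^j x
  -- W^(p-1-j); in characteristic p this is the (p - 1)-fold commutator with W.
  have hd : derivative (W ^ p) = ((LinearMap.mulLeft F W - LinearMap.mulRight F W) ^ (p - 1) :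
      Module.End F B[X]) (C x) := by
    rw [Commute.sub_pow_prime_sub_one (F := F) p (LinearMap.commute_mulLeft_right W W),
      derivative_pow_eq_sum]
    simp [LinearMap.sum_apply, LinearMap.pow_mulLeft, LinearMap.pow_mulRight, hW, mul_assoc]
  have hs : ∀ i ∈ Finset.Icc 1 (p - 1), (ofAssociative F B).s p i x y = (W ^ p).coeff i := by
    intro i hi
    rw [Finset.mem_Icc] at hi
    have hne : (i : F) ≠ 0 := by
      rw [Ne, CharP.cast_eq_zero_iff F p]
      exact Nat.not_dvd_of_pos_of_lt (by omega) (by omega)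
    have hi' : ((i - 1 : ℕ) : B) + 1 = i := by
      rw [← Nat.cast_succ]; congr 1; omega
    rw [s, ← coeff_iterate_commutator, ← hW, ← hd, coeff_derivative, Nat.sub_add_cancel hi.1, hi',
      inv_smul_eq_iff₀ hne, Algebra.smul_def, map_natCast, (Nat.cast_commute i _).eq]
  have hdeg : W.natDegree ≤ 1 := by rw [hW]; compute_degree
  have h0 : (W ^ p).coeff 0 = y ^ p := by
    rw [← constantCoeff_apply, map_pow]; simp [hW]
  have hp' : (W ^ p).coeff p = x ^ p := by
    have := coeff_pow_of_natDegree_le (m := p) hdeg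
    rw [mul_one] at this
    rw [this]; simp [hW, coeff_C]
  -- Evaluation at the central element T = 1 is multiplicative even for noncommutative B.
  have h1 : ∑ i ∈ Finset.range (p + 1), (W ^ p).coeff i = (x + y) ^ p := by
    have he := map_pow (eval₂RingHom' (RingHom.id B) 1 fun a => Commute.one_right a) W p
    simp only [eval₂RingHom', RingHom.coe_mk, MonoidHom.coe_mk, OneHom.coe_mk] at he
    rw [eval₂_id, eval₂_id, eval_eq_sum_range' (n := p + 1)] at he
    · simpa [hW] using he
    · have := natDegree_pow_le_of_le p hdeg
      omega
  rw [jacobsonSum, Finset.sum_congr rfl hs, ← h1, Finset.sum_range_succ, hp',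
    Finset.range_eq_Ico, Finset.sum_eq_sum_Ico_succ_bot (by omega), h0]
  have : Finset.Icc 1 (p - 1) = Finset.Ico (0 + 1) p := by ext; simp; omega
  rw [this]
  abel

/-! ### Derivations and the graded representation. -/

theorem bracket_swap (A : HomLieAlgebra F L) (x y : L) : A.bracket x y = -A.bracket y x := by
  have h := A.bracket_self (x + y)
  simp only [map_add, LinearMap.add_apply, A.bracket_self, zero_add, add_zero] at h
  exact eq_neg_of_add_eq_zero_right h

theorem IsMultiplicative.twist_pow_bracket {A : HomLieAlgebra F L} (hA : A.IsMultiplicative)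
    (n : ℕ) (x y : L) :
    (A.twist ^ n) (A.bracket x y) = A.bracket ((A.twist ^ n) x) ((A.twist ^ n) y) := by
  induction n with
  | zero => rfl
  | succ n ih => simp only [pow_succ', Module.End.mul_apply, ih]; exact hA _ _

theorem bracket_twist_bracket (A : HomLieAlgebra F L) (x y z : L) :
    A.bracket (A.bracket x y) (A.twist z) =
      A.bracket (A.twist x) (A.bracket y z) - A.bracket (A.twist y) (A.bracket x z) := by
  have h := A.hom_jacobi x y z
  rw [A.bracket_swap z x, map_neg, A.bracket_swap (A.twist z)] at h
  rw [eq_comm, ← sub_eq_zero, ← h]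
  abel

/-- A derivation of a Hom-Lie algebra that commutes with the twist. -/
structure IsDerivation (A : HomLieAlgebra F L) (D : L →ₗ[F] L) : Prop where
  leibniz : ∀ x y, D (A.bracket x y) = A.bracket (D x) y + A.bracket x (D y)
  comm_twist : ∀ x, D (A.twist x) = A.twist (D x)

theorem IsDerivation.comm_twist_pow {A : HomLieAlgebra F L} {D : L →ₗ[F] L} (hD : A.IsDerivation D)
    (n : ℕ) (x : L) : D ((A.twist ^ n) x) = (A.twist ^ n) (D x) := by
  induction n with
  | zero => rfl
  | succ n ih => simp only [pow_succ', Module.End.mul_apply, hD.comm_twist, ih]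

theorem isDerivation_zero (A : HomLieAlgebra F L) : A.IsDerivation 0 := ⟨by simp, by simp⟩

/-- For a multiplicative Hom-Lie algebra with a derivation `D`, the spaces `L t ^ (n + 1)` form a
graded Lie algebra with bracket `[x t ^ (m + 1), y t ^ (n + 1)] = [α^n x, α^m y] t ^ (m + n + 2)`.
`A.rep D n x` is the action of `x t ^ (n + 1)` on its extension by the derivation `-D`. -/
noncomputable def rep (A : HomLieAlgebra F L) (D : L →ₗ[F] L) (n : ℕ) :
    L →ₗ[F] Module.End F ((ℕ →₀ L) × F) where
  toFun x := LinearMap.inl F (ℕ →₀ L) F ∘ₗ LinearMap.coprod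
    (Finsupp.lsum F fun m =>
      Finsupp.lsingle (m + n + 1) ∘ₗ A.bracket ((A.twist ^ m) x) ∘ₗ A.twist ^ n)
    (LinearMap.toSpanSingleton F _ (Finsupp.single n (D x)))
  map_add' x y := by ext <;> simp [Finsupp.single_apply]
  map_smul' c x := by ext <;> simp

@[simp]
theorem rep_single (A : HomLieAlgebra F L) (D : L →ₗ[F] L) (n m : ℕ) (x v : L) :
    A.rep D n x (Finsupp.single m v, 0) =
      (Finsupp.single (m + n + 1) (A.bracket ((A.twist ^ m) x) ((A.twist ^ n) v)), 0) := by
  simp [rep]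

@[simp]
theorem rep_zero_one (A : HomLieAlgebra F L) (D : L →ₗ[F] L) (n : ℕ) (x : L) :
    A.rep D n x (0, 1) = (Finsupp.single n (D x), 0) := by
  simp [rep]

/-- On the summand of sequences this is the Hom-Jacobi identity, with multiplicativity moving powers
of α inside brackets; on (0, 1) it is the Leibniz rule. Commutators with degree index 0 suffice,
since `adCoeff` only brackets by powers of α applied to x or y. -/
theorem rep_commutator {A : HomLieAlgebra F L} (hA : A.IsMultiplicative) {D : L →ₗ[F] L}
    (hD : A.IsDerivation D) (n : ℕ) (x y : L) :
    A.rep D 0 x * A.rep D n y - A.rep D n y * A.rep D 0 x =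
      A.rep D (n + 1) (A.bracket ((A.twist ^ n) x) y) := by
  refine LinearMap.prod_ext (Finsupp.lhom_ext fun k v => ?_) (LinearMap.ext_ring ?_)
  · simp only [LinearMap.comp_apply, LinearMap.inl_apply, LinearMap.sub_apply,
      Module.End.mul_apply, rep_single, Prod.mk_sub_mk, sub_self]
    have h1 : k + n + 1 + 0 + 1 = k + (n + 1) + 1 := by ring
    have h2 : k + 0 + 1 + n + 1 = k + (n + 1) + 1 := by ring
    have hx : (A.twist ^ (k + n + 1)) x = A.twist ((A.twist ^ k) ((A.twist ^ n) x)) := by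
      rw [pow_succ', pow_add]; rfl
    have hx' : (A.twist ^ n) ((A.twist ^ k) x) = (A.twist ^ k) ((A.twist ^ n) x) := by
      rw [← Module.End.mul_apply, ← Module.End.mul_apply, ← pow_add, ← pow_add, add_comm]
    rw [h1, h2, ← Finsupp.single_sub, hA.twist_pow_bracket k, hA.twist_pow_bracket n, add_zero, hx,
      hx', pow_zero, Module.End.one_apply, pow_succ' _ n, Module.End.mul_apply,
      bracket_twist_bracket, pow_succ' _ k, Module.End.mul_apply, Module.End.one_apply]
  · simp only [LinearMap.comp_apply, LinearMap.inr_apply, LinearMap.sub_apply,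
      Module.End.mul_apply, rep_zero_one, rep_single, Prod.mk_sub_mk, sub_self, hD.leibniz,
      hD.comm_twist_pow]
    have h1 : n + 0 + 1 = n + 1 := by ring
    have h2 : 0 + n + 1 = n + 1 := by ring
    rw [h1, h2, ← Finsupp.single_sub, A.bracket_swap _ y]
    simp [add_comm, sub_eq_add_neg]

theorem rep_adCoeff {A : HomLieAlgebra F L} (hA : A.IsMultiplicative) {D : L →ₗ[F] L}
    (hD : A.IsDerivation D) (x y : L) (n i : ℕ) :
    A.rep D n (A.adCoeff x y n i) =
      (ofAssociative F _).adCoeff (A.rep D 0 x) (A.rep D 0 y) n i := by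
  induction n generalizing i with
  | zero => cases i <;> simp [adCoeff]
  | succ n ih =>
    cases i <;>
      simp only [adCoeff, ofAssociative_ad_twist, ← ih, rep_commutator hA hD, map_add] <;> rfl

/-- The index of the vector counts the factors already applied, and so supplies the power of α for
the next one. -/
theorem rep_zero_pow_single (A : HomLieAlgebra F L) (D : L →ₗ[F] L) (n : ℕ) (x v : L) :
    (A.rep D 0 x ^ n) (Finsupp.single 0 v, 0) = (Finsupp.single n (A.adIter n x v), 0) := by
  induction n with
  | zero => simp [adIter]
  | succ n ih => rw [pow_succ', Module.End.mul_apply, ih, rep_single]; simp [adIter, ad]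

theorem rep_jacobsonSum {A : HomLieAlgebra F L} (hA : A.IsMultiplicative) {D : L →ₗ[F] L}
    (hD : A.IsDerivation D) (p : ℕ) [Fact p.Prime] [CharP F p] (x y : L) :
    A.rep D (p - 1) (A.jacobsonSum p x y) =
      A.rep D 0 (x + y) ^ p - A.rep D 0 x ^ p - A.rep D 0 y ^ p := by
  rw [map_add, ← ofAssociative_jacobsonSum (F := F), jacobsonSum, jacobsonSum, map_sum]
  exact Finset.sum_congr rfl fun i _ => by rw [s, s, map_smul, rep_adCoeff hA hD]

/-- Jacobson's formula in the representation with D = 0, applied to a vector in degree 0. -/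
theorem ad_jacobsonSum {A : HomLieAlgebra F L} (hA : A.IsMultiplicative)
    (p : ℕ) [hp : Fact p.Prime] [CharP F p] (x y : L) :
    A.ad (A.jacobsonSum p x y) ∘ₗ (A.twist ^ (p - 1)) =
      A.adIter p (x + y) - A.adIter p x - A.adIter p y := by
  ext z
  have h := LinearMap.congr_fun (rep_jacobsonSum hA A.isDerivation_zero p x y)
    (Finsupp.single 0 z, 0)
  simp only [LinearMap.sub_apply, rep_single, rep_zero_pow_single, Prod.mk_sub_mk, sub_self,
    zero_add, Nat.sub_add_cancel hp.out.one_le, ← Finsupp.single_sub] at h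
  exact Finsupp.single_injective _ (congrArg Prod.fst h)

/-- The derivative of `s₁(x, y) + ⋯ + s_{p-1}(x, y)`, which plays the role of
`(x + y) ^ p - x ^ p - y ^ p`. -/
theorem IsDerivation.jacobsonSum {A : HomLieAlgebra F L} (hA : A.IsMultiplicative)
    {D : L →ₗ[F] L} (hD : A.IsDerivation D) (p : ℕ) [hp : Fact p.Prime] [CharP F p] (x y : L) :
    D (A.jacobsonSum p x y) = A.adIter (p - 1) (x + y) (D (x + y)) -
      A.adIter (p - 1) x (D x) - A.adIter (p - 1) y (D y) := by
  have h := LinearMap.congr_fun (rep_jacobsonSum hA hD p x y) (0, 1)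
  -- The first factor turns (0, 1) into D z in degree 0; the other p - 1 factors act as iterated
  -- brackets.
  have hpow : ∀ z, (A.rep D 0 z ^ p) (0, 1) =
      (Finsupp.single (p - 1) (A.adIter (p - 1) z (D z)), 0) := by
    intro z
    obtain ⟨q, rfl⟩ : ∃ q, p = q + 1 := ⟨p - 1, (Nat.sub_add_cancel hp.out.one_le).symm⟩
    rw [pow_succ, Module.End.mul_apply, rep_zero_one, rep_zero_pow_single, Nat.add_sub_cancel]
  simp only [LinearMap.sub_apply, rep_zero_one, hpow, Prod.mk_sub_mk, sub_self,
    ← Finsupp.single_sub] at h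
  exact Finsupp.single_injective _ (congrArg Prod.fst h)

/-! ### The Hom-Lie algebra L[T] and its Euler derivation. -/

/-- The bracket of polynomials with coefficients in `L`. -/
noncomputable def polynomialBracket (A : HomLieAlgebra F L) :
    (ℕ →₀ L) →ₗ[F] (ℕ →₀ L) →ₗ[F] (ℕ →₀ L) :=
  Finsupp.lsum F fun i => LinearMap.flip <| Finsupp.lsum F fun j =>
    LinearMap.flip (A.bracket.compr₂ (Finsupp.lsingle (i + j)))

@[simp]
theorem polynomialBracket_single (A : HomLieAlgebra F L) (i j : ℕ) (x y : L) :
    A.polynomialBracket (Finsupp.single i x) (Finsupp.single j y) =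
      Finsupp.single (i + j) (A.bracket x y) := by
  simp [polynomialBracket]

/-- A bilinear identity on `L[T]` may be checked on monomials. -/
theorem bilinear_ext {M : Type*} [AddCommGroup M] [Module F M]
    {b c : (ℕ →₀ L) →ₗ[F] (ℕ →₀ L) →ₗ[F] M}
    (h : ∀ i x j y, b (Finsupp.single i x) (Finsupp.single j y) =
      c (Finsupp.single i x) (Finsupp.single j y)) : b = c :=
  Finsupp.lhom_ext fun i x => Finsupp.lhom_ext fun j y => h i x j y

theorem polynomialBracket_swap (A : HomLieAlgebra F L) (f g : ℕ →₀ L) :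
    A.polynomialBracket f g = -A.polynomialBracket g f := by
  have h : A.polynomialBracket = -A.polynomialBracket.flip :=
    bilinear_ext fun i x j y => by
      simp only [LinearMap.neg_apply, LinearMap.flip_apply, polynomialBracket_single]
      rw [A.bracket_swap, add_comm i j, Finsupp.single_neg]
  exact LinearMap.congr_fun₂ h f g

/-- The Hom-Lie algebra `L[T]` of polynomials with coefficients in `L`. -/
noncomputable def polynomial (A : HomLieAlgebra F L) : HomLieAlgebra F (ℕ →₀ L) where
  bracket := A.polynomialBracket
  twist := Finsupp.mapRange.linearMap A.twist
  bracket_self f := by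
    induction f using Finsupp.induction_linear with
    | zero => simp
    | add f g hf hg =>
      simp only [map_add, LinearMap.add_apply, hf, hg, zero_add, add_zero]
      rw [A.polynomialBracket_swap g f, neg_add_cancel]
    | single i x => simp [A.bracket_self]
  hom_jacobi f g h := by
    induction f using Finsupp.induction_linear with
    | zero => simp
    | add f f' hf hf' =>
      simp only [map_add, LinearMap.add_apply]
      refine Eq.trans ?_ ((congrArg₂ (· + ·) hf hf').trans (add_zero 0))
      abel
    | single i x =>
    induction g using Finsupp.induction_linear with
    | zero => simp
    | add f f' hf hf' =>
      simp only [map_add, LinearMap.add_apply]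
      refine Eq.trans ?_ ((congrArg₂ (· + ·) hf hf').trans (add_zero 0))
      abel
    | single j y =>
    induction h using Finsupp.induction_linear with
    | zero => simp
    | add f f' hf hf' =>
      simp only [map_add, LinearMap.add_apply]
      refine Eq.trans ?_ ((congrArg₂ (· + ·) hf hf').trans (add_zero 0))
      abel
    | single k z =>
      have h1 : j + (k + i) = i + (j + k) := by ring
      have h2 : k + (i + j) = i + (j + k) := by ring
      simp [h1, h2, ← Finsupp.single_add, A.hom_jacobi]

@[simp]
theorem polynomial_bracket_single (A : HomLieAlgebra F L) (i j : ℕ) (x y : L) :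
    A.polynomial.bracket (Finsupp.single i x) (Finsupp.single j y) =
      Finsupp.single (i + j) (A.bracket x y) := by
  simp [polynomial]

@[simp]
theorem polynomial_twist_single (A : HomLieAlgebra F L) (i : ℕ) (x : L) :
    A.polynomial.twist (Finsupp.single i x) = Finsupp.single i (A.twist x) := by
  simp [polynomial]

theorem IsMultiplicative.polynomial {A : HomLieAlgebra F L} (hA : A.IsMultiplicative) :
    A.polynomial.IsMultiplicative := by
  have h : A.polynomial.bracket.compr₂ A.polynomial.twist =
      A.polynomial.bracket.compl₁₂ A.polynomial.twist A.polynomial.twist :=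
    bilinear_ext fun i x j y => by simp [hA x y]
  exact fun f g => LinearMap.congr_fun₂ h f g

/-- The derivation `T d/dT` of `L[T]`. -/
noncomputable def euler (F L : Type*) [Field F] [AddCommGroup L] [Module F L] :
    (ℕ →₀ L) →ₗ[F] (ℕ →₀ L) :=
  Finsupp.lsum F fun i => (i : F) • Finsupp.lsingle i

@[simp]
theorem euler_single (i : ℕ) (x : L) :
    euler F L (Finsupp.single i x) = (i : F) • Finsupp.single i x := by
  simp [euler]

theorem euler_apply (f : ℕ →₀ L) (i : ℕ) : euler F L f i = (i : F) • f i := by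
  induction f using Finsupp.induction_linear with
  | zero => simp
  | add f g hf hg => simp [hf, hg]
  | single j x =>
    rw [euler_single]
    by_cases h : j = i <;> simp [h]

theorem isDerivation_euler (A : HomLieAlgebra F L) : A.polynomial.IsDerivation (euler F L) where
  leibniz f g := by
    have h : A.polynomial.bracket.compr₂ (euler F L) =
        A.polynomial.bracket.comp (euler F L) + A.polynomial.bracket.compl₂ (euler F L) :=
      bilinear_ext fun i x j y => by
        simp only [LinearMap.compr₂_apply, LinearMap.add_apply, LinearMap.comp_apply,
          LinearMap.compl₂_apply, polynomial_bracket_single, euler_single, map_smul,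
          LinearMap.smul_apply, Nat.cast_add, add_smul]
    exact LinearMap.congr_fun₂ h f g
  comm_twist f := by
    have h : euler F L ∘ₗ A.polynomial.twist = A.polynomial.twist ∘ₗ euler F L :=
      Finsupp.lhom_ext fun i x => by
        simp only [LinearMap.comp_apply, polynomial_twist_single, euler_single, map_smul]
    exact LinearMap.congr_fun h f

/-! ### Homomorphisms and evaluation at T = 1 and T = 0. -/

/-- A homomorphism of Hom-Lie algebras. -/
structure IsHom {L' : Type*} [AddCommGroup L'] [Module F L'] (A : HomLieAlgebra F L)
    (A' : HomLieAlgebra F L') (φ : L →ₗ[F] L') : Prop where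
  map_bracket : ∀ x y, φ (A.bracket x y) = A'.bracket (φ x) (φ y)
  map_twist : ∀ x, φ (A.twist x) = A'.twist (φ x)

namespace IsHom

variable {L' : Type*} [AddCommGroup L'] [Module F L'] {A : HomLieAlgebra F L}
  {A' : HomLieAlgebra F L'} {φ : L →ₗ[F] L'}

theorem map_twist_pow (h : A.IsHom A' φ) (n : ℕ) (x : L) :
    φ ((A.twist ^ n) x) = (A'.twist ^ n) (φ x) := by
  induction n with
  | zero => rfl
  | succ n ih => simp only [pow_succ', Module.End.mul_apply, h.map_twist, ih]

theorem map_adCoeff (h : A.IsHom A' φ) (x y : L) (n i : ℕ) :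
    φ (A.adCoeff x y n i) = A'.adCoeff (φ x) (φ y) n i := by
  induction n generalizing i with
  | zero => cases i <;> simp [adCoeff]
  | succ n ih => cases i <;> simp [adCoeff, ad, h.map_bracket, h.map_twist_pow, ih]

theorem map_jacobsonSum (h : A.IsHom A' φ) (p : ℕ) (x y : L) :
    φ (A.jacobsonSum p x y) = A'.jacobsonSum p (φ x) (φ y) := by
  simp [jacobsonSum, s, h.map_adCoeff]

end IsHom

theorem isHom_evalOne (A : HomLieAlgebra F L) :
    A.polynomial.IsHom A (Finsupp.lsum F fun _ => LinearMap.id) where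
  map_bracket f g := by
    have h : A.polynomial.bracket.compr₂ (Finsupp.lsum F fun _ => LinearMap.id) =
        A.bracket.compl₁₂ (Finsupp.lsum F fun _ => LinearMap.id)
          (Finsupp.lsum F fun _ => LinearMap.id) :=
      bilinear_ext fun i x j y => by
        simp only [LinearMap.compr₂_apply, LinearMap.compl₁₂_apply, polynomial_bracket_single,
          Finsupp.lsum_single, LinearMap.id_apply]
    exact LinearMap.congr_fun₂ h f g
  map_twist f := by
    have h : (Finsupp.lsum F fun _ => LinearMap.id) ∘ₗ A.polynomial.twist =
        A.twist ∘ₗ (Finsupp.lsum F fun _ => LinearMap.id) :=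
      Finsupp.lhom_ext fun i x => by
        simp only [LinearMap.comp_apply, polynomial_twist_single, Finsupp.lsum_single,
          LinearMap.id_apply]
    exact LinearMap.congr_fun h f

theorem isHom_evalZero (A : HomLieAlgebra F L) :
    A.polynomial.IsHom A (Finsupp.lapply 0) where
  map_bracket f g := by
    have h : A.polynomial.bracket.compr₂ (Finsupp.lapply 0) =
        A.bracket.compl₁₂ (Finsupp.lapply 0) (Finsupp.lapply 0) :=
      bilinear_ext fun i x j y => by
        simp only [LinearMap.compr₂_apply, LinearMap.compl₁₂_apply, polynomial_bracket_single,
          Finsupp.lapply_apply, Finsupp.single_apply]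
        by_cases hi : i = 0 <;> by_cases hj : j = 0 <;> simp [hi, hj]
    exact LinearMap.congr_fun₂ h f g
  map_twist f := by simp [polynomial]

/-! ### Degree bounds in L[T]. -/

theorem polynomial_bracket_mem (A : HomLieAlgebra F L) {d e : ℕ} {f g : ℕ →₀ L}
    (hf : f ∈ Finsupp.supported L F (Set.Iic d)) (hg : g ∈ Finsupp.supported L F (Set.Iic e)) :
    A.polynomial.bracket f g ∈ Finsupp.supported L F (Set.Iic (d + e)) := by
  rw [← f.sum_single, ← g.sum_single]
  simp only [Finsupp.sum, map_sum, LinearMap.sum_apply, polynomial_bracket_single]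
  refine Submodule.sum_mem _ fun j hj => Submodule.sum_mem _ fun i hi => ?_
  exact Finsupp.single_mem_supported F _ (Set.mem_Iic.2 (add_le_add (hf hi) (hg hj)))

theorem polynomial_twist_pow_mem (A : HomLieAlgebra F L) {d : ℕ} (n : ℕ) {f : ℕ →₀ L}
    (hf : f ∈ Finsupp.supported L F (Set.Iic d)) :
    (A.polynomial.twist ^ n) f ∈ Finsupp.supported L F (Set.Iic d) := by
  induction n with
  | zero => exact hf
  | succ n ih =>
    rw [pow_succ', Module.End.mul_apply]
    exact fun i hi => ih (Finsupp.support_mapRange (hf := map_zero A.twist) hi)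

theorem supported_Iic_mono {d e : ℕ} (h : d ≤ e) {f : ℕ →₀ L}
    (hf : f ∈ Finsupp.supported L F (Set.Iic d)) : f ∈ Finsupp.supported L F (Set.Iic e) :=
  Finsupp.supported_mono (Set.Iic_subset_Iic.2 h) hf

/-- Only occurrences of f raise the degree: the innermost one and the i counted by the coefficient
index. For i ≤ p - 2 this stays below p. -/
theorem adCoeff_mem_of_right (A : HomLieAlgebra F L) {f g : ℕ →₀ L}
    (hf : f ∈ Finsupp.supported L F (Set.Iic 1)) (hg : g ∈ Finsupp.supported L F (Set.Iic 0))
    (n i : ℕ) : A.polynomial.adCoeff f g n i ∈ Finsupp.supported L F (Set.Iic (i + 1)) := by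
  induction n generalizing i with
  | zero =>
    cases i with
    | zero => exact hf
    | succ i => exact Submodule.zero_mem _
  | succ n ih =>
    have hg' := A.polynomial_twist_pow_mem n hg
    have hf' := A.polynomial_twist_pow_mem n hf
    cases i with
    | zero => exact supported_Iic_mono (by omega) (A.polynomial_bracket_mem hg' (ih 0))
    | succ i =>
      exact Submodule.add_mem _
        (supported_Iic_mono (by omega) (A.polynomial_bracket_mem hf' (ih i)))
        (supported_Iic_mono (by omega) (A.polynomial_bracket_mem hg' (ih (i + 1))))

/-- The innermost entry f is constant and each of the n brackets raises the degree by at most 1;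
here n will be p - 1. -/
theorem adCoeff_mem_of_left (A : HomLieAlgebra F L) {f g : ℕ →₀ L}
    (hf : f ∈ Finsupp.supported L F (Set.Iic 0)) (hg : g ∈ Finsupp.supported L F (Set.Iic 1))
    (n i : ℕ) : A.polynomial.adCoeff f g n i ∈ Finsupp.supported L F (Set.Iic n) := by
  induction n generalizing i with
  | zero =>
    cases i with
    | zero => exact hf
    | succ i => exact Submodule.zero_mem _
  | succ n ih =>
    have hg' := A.polynomial_twist_pow_mem n hg
    have hf' := A.polynomial_twist_pow_mem n hf
    cases i with
    | zero => exact supported_Iic_mono (by omega) (A.polynomial_bracket_mem hg' (ih 0))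
    | succ i =>
      exact Submodule.add_mem _
        (supported_Iic_mono (by omega) (A.polynomial_bracket_mem hf' (ih i)))
        (supported_Iic_mono (by omega) (A.polynomial_bracket_mem hg' (ih (i + 1))))

theorem jacobsonSum_mem_of_right (A : HomLieAlgebra F L) (p : ℕ) {f g : ℕ →₀ L}
    (hf : f ∈ Finsupp.supported L F (Set.Iic 1)) (hg : g ∈ Finsupp.supported L F (Set.Iic 0)) :
    A.polynomial.jacobsonSum p f g ∈ Finsupp.supported L F (Set.Iic (p - 1)) := by
  refine Submodule.sum_mem _ fun i hi => Submodule.smul_mem _ _ ?_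
  rw [Finset.mem_Icc] at hi
  exact supported_Iic_mono (by omega) (A.adCoeff_mem_of_right hf hg _ _)

theorem jacobsonSum_mem_of_left (A : HomLieAlgebra F L) (p : ℕ) {f g : ℕ →₀ L}
    (hf : f ∈ Finsupp.supported L F (Set.Iic 0)) (hg : g ∈ Finsupp.supported L F (Set.Iic 1)) :
    A.polynomial.jacobsonSum p f g ∈ Finsupp.supported L F (Set.Iic (p - 1)) :=
  Submodule.sum_mem _ fun _ _ => Submodule.smul_mem _ _ (A.adCoeff_mem_of_left hf hg _ _)

/-- A polynomial of degree less than `p` with zero derivative and zero constant term vanishes. -/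
theorem eq_zero_of_euler_eq_zero (p : ℕ) [hp : Fact p.Prime] [CharP F p] {f : ℕ →₀ L}
    (hf : f ∈ Finsupp.supported L F (Set.Iic (p - 1))) (h0 : f 0 = 0) (hD : euler F L f = 0) :
    f = 0 := by
  have h2 := hp.out.two_le
  ext i
  rcases Nat.eq_zero_or_pos i with rfl | hi
  · exact h0
  by_cases hip : i ≤ p - 1
  · have h := euler_apply (F := F) f i
    rw [hD, Finsupp.zero_apply, eq_comm, smul_eq_zero, CharP.cast_eq_zero_iff F p] at h
    exact h.resolve_left (Nat.not_dvd_of_pos_of_lt hi (by omega))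
  · by_contra hne
    exact hip (hf (Finsupp.mem_support_iff.2 hne))

/-! ### Homogeneity, symmetry and cocycle identity of the Jacobson sum. -/

theorem adCoeff_smul_smul_self (A : HomLieAlgebra F L) (k l : F) (x : L) (n i : ℕ) :
    A.adCoeff (k • x) (l • x) (n + 1) i = 0 := by
  induction n generalizing i with
  | zero => rcases i with _ | _ | i <;> simp [adCoeff, ad, A.bracket_self]
  | succ n ih =>
    cases i with
    | zero => rw [adCoeff, ih, map_zero]
    | succ i => rw [adCoeff, ih, ih, map_zero, map_zero, add_zero]

theorem jacobsonSum_smul_smul_self (A : HomLieAlgebra F L) (p : ℕ) [hp : Fact p.Prime]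
    (k l : F) (x : L) : A.jacobsonSum p (k • x) (l • x) = 0 := by
  have h2 := hp.out.two_le
  refine Finset.sum_eq_zero fun i _ => ?_
  -- Since p ≥ 2, at least one bracket of proportional vectors occurs.
  rw [s, show p - 1 = p - 2 + 1 by omega, adCoeff_smul_smul_self, smul_zero]

theorem jacobsonSum_zero_right (A : HomLieAlgebra F L) (p : ℕ) [Fact p.Prime] (x : L) :
    A.jacobsonSum p x 0 = 0 := by
  simpa using A.jacobsonSum_smul_smul_self p 1 0 x

theorem jacobsonSum_zero_left (A : HomLieAlgebra F L) (p : ℕ) [Fact p.Prime] (x : L) :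
    A.jacobsonSum p 0 x = 0 := by
  simpa using A.jacobsonSum_smul_smul_self p 0 1 x

theorem adCoeff_smul_smul (A : HomLieAlgebra F L) (k : F) (x y : L) (n i : ℕ) :
    A.adCoeff (k • x) (k • y) n i = k ^ (n + 1) • A.adCoeff x y n i := by
  induction n generalizing i with
  | zero => cases i <;> simp [adCoeff]
  | succ n ih =>
    cases i <;> simp [adCoeff, ad, ih, smul_smul, pow_succ k (n + 1)]

theorem jacobsonSum_smul_smul (A : HomLieAlgebra F L) (p : ℕ) [hp : Fact p.Prime] (k : F)
    (x y : L) : A.jacobsonSum p (k • x) (k • y) = k ^ p • A.jacobsonSum p x y := by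
  simp only [jacobsonSum, s, adCoeff_smul_smul, Nat.sub_add_cancel hp.out.one_le, Finset.smul_sum,
    smul_comm (k ^ p)]

theorem jacobsonSum_comm {A : HomLieAlgebra F L} (hA : A.IsMultiplicative) (p : ℕ)
    [Fact p.Prime] [CharP F p] (x y : L) :
    A.jacobsonSum p x y = A.jacobsonSum p y x := by
  set f : ℕ →₀ L := Finsupp.single 1 x
  set g : ℕ →₀ L := Finsupp.single 0 y
  have hf : f ∈ Finsupp.supported L F (Set.Iic 1) :=
    Finsupp.single_mem_supported F _ (Set.mem_Iic.2 le_rfl)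
  have hg : g ∈ Finsupp.supported L F (Set.Iic 0) :=
    Finsupp.single_mem_supported F _ (Set.mem_Iic.2 le_rfl)
  have h0 := A.isHom_evalZero.map_jacobsonSum p
  have h1 := A.isHom_evalOne.map_jacobsonSum p
  have h : A.polynomial.jacobsonSum p f g - A.polynomial.jacobsonSum p g f = 0 := by
    refine eq_zero_of_euler_eq_zero (F := F) p (Submodule.sub_mem _
      (A.jacobsonSum_mem_of_right p hf hg) (A.jacobsonSum_mem_of_left p hg hf)) ?_ ?_
    · rw [Finsupp.sub_apply, ← Finsupp.lapply_apply (R := F), ← Finsupp.lapply_apply (R := F),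
        h0, h0]
      simp [f, jacobsonSum_zero_left, jacobsonSum_zero_right]
    -- The formula for the derivative is already symmetric in f and g.
    · rw [map_sub, A.isDerivation_euler.jacobsonSum hA.polynomial,
        A.isDerivation_euler.jacobsonSum hA.polynomial, add_comm g f]
      abel
  have := congrArg (Finsupp.lsum F fun _ => (LinearMap.id : L →ₗ[F] L)) h
  rw [map_sub, h1, h1, map_zero, sub_eq_zero] at this
  simpa [f, g] using this

theorem jacobsonSum_cocycle {A : HomLieAlgebra F L} (hA : A.IsMultiplicative) (p : ℕ)
    [Fact p.Prime] [CharP F p] (x y z : L) :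
    A.jacobsonSum p x y + A.jacobsonSum p (x + y) z =
      A.jacobsonSum p y z + A.jacobsonSum p x (y + z) := by
  set f : ℕ →₀ L := Finsupp.single 1 x
  set g : ℕ →₀ L := Finsupp.single 0 y
  set h : ℕ →₀ L := Finsupp.single 0 z
  have hf : f ∈ Finsupp.supported L F (Set.Iic 1) :=
    Finsupp.single_mem_supported F _ (Set.mem_Iic.2 le_rfl)
  have hg : g ∈ Finsupp.supported L F (Set.Iic 0) :=
    Finsupp.single_mem_supported F _ (Set.mem_Iic.2 le_rfl)
  have hh : h ∈ Finsupp.supported L F (Set.Iic 0) :=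
    Finsupp.single_mem_supported F _ (Set.mem_Iic.2 le_rfl)
  have h0 := A.isHom_evalZero.map_jacobsonSum p
  have h1 := A.isHom_evalOne.map_jacobsonSum p
  have hz : A.polynomial.jacobsonSum p f g + A.polynomial.jacobsonSum p (f + g) h -
      (A.polynomial.jacobsonSum p g h + A.polynomial.jacobsonSum p f (g + h)) = 0 := by
    refine eq_zero_of_euler_eq_zero (F := F) p (Submodule.sub_mem _
      (Submodule.add_mem _ (A.jacobsonSum_mem_of_right p hf hg)
        (A.jacobsonSum_mem_of_right p
          (Submodule.add_mem _ hf (supported_Iic_mono zero_le_one hg)) hh))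
      (Submodule.add_mem _
        (A.jacobsonSum_mem_of_right p (supported_Iic_mono zero_le_one hg) hh)
        (A.jacobsonSum_mem_of_right p hf (Submodule.add_mem _ hg hh)))) ?_ ?_
    -- At T = 0 the element f vanishes and both sides become s(y, z).
    · rw [← Finsupp.lapply_apply (R := F), map_sub, map_add, map_add, h0, h0, h0, h0]
      simp [f, jacobsonSum_zero_left]
    -- The derivative of s is a coboundary, so the terms for f + g and g + h cancel.
    · simp only [map_sub, map_add (euler F L) (A.polynomial.jacobsonSum p _ _),
        A.isDerivation_euler.jacobsonSum hA.polynomial, add_assoc f g h]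
      abel
  have := congrArg (Finsupp.lsum F fun _ => (LinearMap.id : L →ₗ[F] L)) hz
  rw [map_sub, map_add, map_add, h1, h1, h1, h1, map_zero, sub_eq_zero, map_add, map_add] at this
  simpa [f, g, h] using this

/-! ### The vector space whose linear sections satisfy conditions 2 and 3. -/

/-- The extension of the `F`-module `L` by its Frobenius twist given by the cocycle `jacobsonSum`.
A `p`-structure is the second component of a linear section of the projection onto `L`. -/
structure JacobsonExtension (A : HomLieAlgebra F L) (hA : A.IsMultiplicative) (p : ℕ) where
  fst : L
  snd : L

namespace JacobsonExtension

attribute [ext] JacobsonExtension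

variable {A : HomLieAlgebra F L} {hA : A.IsMultiplicative} {p : ℕ}

instance : Add (A.JacobsonExtension hA p) :=
  ⟨fun u v => ⟨u.fst + v.fst, u.snd + v.snd + A.jacobsonSum p u.fst v.fst⟩⟩

instance : Zero (A.JacobsonExtension hA p) := ⟨⟨0, 0⟩⟩

/-- No correction term appears, because s(-x, x) = 0. -/
instance : Neg (A.JacobsonExtension hA p) := ⟨fun u => ⟨-u.fst, -u.snd⟩⟩

instance : SMul F (A.JacobsonExtension hA p) := ⟨fun k u => ⟨k • u.fst, k ^ p • u.snd⟩⟩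

@[simp]
theorem fst_add (u v : A.JacobsonExtension hA p) : (u + v).fst = u.fst + v.fst := rfl

@[simp]
theorem snd_add (u v : A.JacobsonExtension hA p) :
    (u + v).snd = u.snd + v.snd + A.jacobsonSum p u.fst v.fst := rfl

@[simp]
theorem fst_zero : (0 : A.JacobsonExtension hA p).fst = 0 := rfl

@[simp]
theorem snd_zero : (0 : A.JacobsonExtension hA p).snd = 0 := rfl

@[simp]
theorem fst_neg (u : A.JacobsonExtension hA p) : (-u).fst = -u.fst := rfl

@[simp]
theorem snd_neg (u : A.JacobsonExtension hA p) : (-u).snd = -u.snd := rfl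

@[simp]
theorem fst_smul (k : F) (u : A.JacobsonExtension hA p) : (k • u).fst = k • u.fst := rfl

@[simp]
theorem snd_smul (k : F) (u : A.JacobsonExtension hA p) : (k • u).snd = k ^ p • u.snd := rfl

variable [hp : Fact p.Prime] [CharP F p]

/-- Associativity is the cocycle identity and commutativity the symmetry of s. Both rest on
multiplicativity, hence `hA` in the type. -/
instance : AddCommGroup (A.JacobsonExtension hA p) where
  add_assoc u v w := by
    ext
    · simp [add_assoc]
    · have h := jacobsonSum_cocycle hA p u.fst v.fst w.fst
      simp only [snd_add, fst_add]
      calc _ = u.snd + v.snd + w.snd + (A.jacobsonSum p u.fst v.fst +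
            A.jacobsonSum p (u.fst + v.fst) w.fst) := by abel
        _ = _ := by rw [h]; abel
  zero_add u := by ext <;> simp [jacobsonSum_zero_left]
  add_zero u := by ext <;> simp [jacobsonSum_zero_right]
  nsmul := nsmulRec
  zsmul := zsmulRec
  neg_add_cancel u := by
    ext
    · simp
    · simpa using A.jacobsonSum_smul_smul_self p (-1) 1 u.fst
  add_comm u v := by
    ext
    · simp [add_comm]
    · simp [jacobsonSum_comm hA p u.fst, add_comm u.snd]

instance : Module F (A.JacobsonExtension hA p) where
  one_smul u := by ext <;> simp
  mul_smul k l u := by ext <;> simp [mul_smul, mul_pow]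
  smul_zero k := by ext <;> simp
  smul_add k u v := by ext <;> simp [jacobsonSum_smul_smul]
  -- Frobenius is additive, and s vanishes on multiples of one vector.
  add_smul k l u := by
    ext <;> simp [add_smul, jacobsonSum_smul_smul_self, add_pow_char]
  zero_smul u := by ext <;> simp [hp.out.ne_zero]

/-- The projection onto the first component. -/
def fstHom : A.JacobsonExtension hA p →ₗ[F] L where
  toFun := fst
  map_add' _ _ := rfl
  map_smul' _ _ := rfl

end JacobsonExtension

/-! ### Existence and uniqueness. -/

theorem adIter_smul (A : HomLieAlgebra F L) (n : ℕ) (k : F) (x : L) :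
    A.adIter n (k • x) = k ^ n • A.adIter n x := by
  induction n with
  | zero => simp [adIter]
  | succ n ih =>
    ext z
    simp [adIter, ad, ih, smul_smul, pow_succ']

end HomLieAlgebra

open HomLieAlgebra in
theorem theorem2p3 {F L J : Type*} [Field F] [AddCommGroup L] [Module F L]
    (p : ℕ) [Fact p.Prime] [CharP F p]
    (A : HomLieAlgebra F L) (hA : A.IsMultiplicative)
    (e : Module.Basis J F L) (y : J → L)
    (hy : ∀ j : J, A.adIter p (e j) = A.ad (y j) ∘ₗ (A.twist ^ (p - 1))) :
    ∃! f : L → L, A.IsPStructure p f ∧ ∀ j : J, f (e j) = y j := by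
  have hp : p ≠ 0 := (Fact.out : p.Prime).ne_zero
  let σ : L →ₗ[F] A.JacobsonExtension hA p := e.constr F fun j => ⟨e j, y j⟩
  have hσ : ∀ j, σ (e j) = ⟨e j, y j⟩ := fun j => e.constr_basis F _ j
  have hfst : ∀ x, (σ x).fst = x := fun x => by
    have h : JacobsonExtension.fstHom ∘ₗ σ = LinearMap.id :=
      e.ext fun j => congrArg JacobsonExtension.fst (hσ j)
    exact LinearMap.congr_fun h x
  have hadd : ∀ x z, (σ (x + z)).snd = (σ x).snd + (σ z).snd + A.jacobsonSum p x z := fun x z => by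
    rw [map_add, JacobsonExtension.snd_add, hfst, hfst]
  have hsmul : ∀ (k : F) x, (σ (k • x)).snd = k ^ p • (σ x).snd := fun k x => by
    rw [map_smul, JacobsonExtension.snd_smul]
  have hbasis : ∀ j, (σ (e j)).snd = y j := fun j => congrArg JacobsonExtension.snd (hσ j)
  have hspan : ∀ x, x ∈ Submodule.span F (Set.range e) := e.mem_span
  refine ⟨fun x => (σ x).snd, ⟨⟨fun x => ?_, hsmul, hadd⟩, hbasis⟩, ?_⟩
  -- Both sides of condition 1 scale by k^p and fail to be additive by the same term, so it is
  -- enough to check the basis.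
  · induction hspan x using Submodule.span_induction with
    | mem x hx =>
      obtain ⟨j, rfl⟩ := hx
      rw [hbasis, hy]
    | zero =>
      have h := A.adIter_smul p 0 0
      have h' := hsmul 0 0
      simp only [smul_zero, zero_pow hp, zero_smul] at h h'
      rw [h, h']
      simp [ad]
    | add x z _ _ hx hz =>
      have h := ad_jacobsonSum hA p x z
      rw [sub_sub, eq_sub_iff_add_eq'] at h
      rw [← h, ← hx, ← hz, hadd]
      simp only [ad, map_add, LinearMap.add_comp]
    | smul k x _ hx =>
      rw [hsmul, adIter_smul, ← hx]
      simp only [ad, map_smul, LinearMap.smul_comp]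
  -- Conditions 2 and 3 alone determine a map from its values on the basis.
  · rintro g ⟨hg, hgy⟩
    funext x
    induction hspan x using Submodule.span_induction with
    | mem x hx =>
      obtain ⟨j, rfl⟩ := hx
      rw [hgy, hbasis]
    | zero =>
      have h := hg.map_smul 0 0
      have h' := hsmul 0 0
      simp only [smul_zero, zero_pow hp, zero_smul] at h h'
      rw [h, h']
    | add x z _ _ hx hz => rw [hg.map_add, hadd, hx, hz, jacobsonSum]
    | smul k x _ hx => rw [hg.map_smul, hsmul, hx]
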